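/- There is an absolute constant $C>0$ such that the following holds. Let $N\ge 1$ be an integer and let $f:\mathbb{R}^2\to\mathbb{R}$ be a function that is zero outside the square $[0,N]\times[0,N]$ and that, on each of the cells $(i,j)+[0,1)^2$ with integers $0\le i,j<N$, is constant and equal to $+1$ or to $-1$. Then there is a circle $K$ in the plane (with arbitrary center, not necessarily contained in the square) of radius $R$, $N/5<R<N/4$, such that $$\left|\int_K f\right|\ge C N^{1/2},$$ where the integral is taken with respect to arc length on $K$. -/

import Mathlib

namespace CheckerboardDiscrepancy

noncomputable section

/-- The Euclidean plane. -/
abbrev Plane : Type := EuclideanSpace ℝ (Fin 2)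

/-- The half-open unit cell `(i, j) + [0,1)²`. -/
def cell (i j : ℕ) : Set Plane :=
  {p | p 0 ∈ Set.Ico (i : ℝ) (i + 1) ∧ p 1 ∈ Set.Ico (j : ℝ) (j + 1)}

/-- The closed square `[0,N] × [0,N]`. -/
def square (N : ℕ) : Set Plane :=
  {p | p 0 ∈ Set.Icc (0 : ℝ) N ∧ p 1 ∈ Set.Icc (0 : ℝ) N}

/-- `f` is a `±1` coloring of the `N × N` checkerboard: it is constant, equal to `1` or to `-1`,
on each cell `(i, j) + [0,1)²` with `0 ≤ i, j < N`, and it is zero outside `[0,N] × [0,N]`.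
Nothing is required on the two edges `x = N` and `y = N` of the closed square, which belong to
none of the cells and which every circle meets in finitely many points only. -/
structure IsColoring (N : ℕ) (f : Plane → ℝ) : Prop where
  const_on_cell : ∀ i < N, ∀ j < N, ∃ c : ℝ, (c = 1 ∨ c = -1) ∧ ∀ p ∈ cell i j, f p = c
  zero_outside : ∀ p, p ∉ square N → f p = 0

/-- The point at angle `θ` on the circle with center `x` and radius `R`. -/
def circlePoint (x : Plane) (R θ : ℝ) : Plane :=
  x + R • !₂[Real.cos θ, Real.sin θ]

/-- The integral of `f` with respect to arc length over the circle with center `x` and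
radius `R > 0`; the line element is `R dθ`. -/
def circleDiscrepancy (f : Plane → ℝ) (x : Plane) (R : ℝ) : ℝ :=
  ∫ θ in (0 : ℝ)..(2 * Real.pi), f (circlePoint x R θ) * R

end

end CheckerboardDiscrepancy

/-!
# A circle with large discrepancy on every checkerboard

The proof is an `L²` argument over all centers and all radii in `(N / 5, N / 4)`, on the Fourier
side. The integral of the coloring along the circle with center `x` and radius `R` is a convolution
of the coloring with arc length, so its Fourier transform is the product of the Fourier transform of
the coloring and a Bessel function: at frequency `ξ`, the transform of arc length is
`R * besselM (R * |ξ|)` with `besselM = 2π J₀`.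

The coloring is a step function with values `±1` on the `N²` cells, so on `[-π, π]²` its transform
is a trigonometric polynomial `boardTransform` with coefficients `±1`, times the transform of the
unit cell. The former has mean square `N²` by Parseval (`integral_torus_norm_sq`) and the latter is
bounded below (`half_le_norm_unitTransform`), so a fixed proportion of the `L²` mass of the coloring
sits at bounded frequencies. There `J₀(R |ξ|)²` is at least of order `1 / N` *on average over `R`*, as the
zeros of `J₀` are averaged out (`exists_le_integral_besselM_sq`). Hence the mean square of the
angular integrals is at least of order `1 / N`, the centers that matter filling an area of order
`N²`. The factor `R` of the line element turns this into arc length integrals of order `√N`.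

To avoid the Fourier transform on the plane, centers are written as `y + n` with an offset `y` in
the unit square and a lattice point `n`. For a fixed offset the circle sums are a convolution on the
lattice, with Fourier series `boardTransform * circleTransform` (`sum_circleSum_mul_expi`), to which
Parseval for trigonometric polynomials applies. By the Cauchy-Schwarz inequality the mean over `y`
of `‖circleTransform‖²` dominates the squared norm of the mean of
`exp (-i y·ξ) * circleTransform`, and the latter mean is exactly the transform of arc length
(without the factor `R`) times that of the unit cell (`integral_expi_mul_circleTransform`).

The lower bound for the Bessel function needs no asymptotic expansion. By Bessel's equation the
energy `H = t (M² + M'²) + M M'` of `M = besselM` satisfies `H' = -M M' / t`, so it stays between two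
positive constants for `t ≥ 1`, and `(t M M')' = t (M'² - M²)` shows that `t M²` and `t M'²` have
nearly the same integral over long intervals. Bounded `t` are dealt with by compactness.
-/

open MeasureTheory Set Filter Topology

/-! ### Mean squares of the Bessel function of order zero -/

/-- `2π J₀(t)`, where `J₀` is the Bessel function of order zero, through its integral
representation. -/
noncomputable def besselM (t : ℝ) : ℝ := ∫ θ in (0 : ℝ)..(2 * Real.pi), Real.cos (t * Real.cos θ)

/-- The derivative of `besselM`. -/
noncomputable def besselM' (t : ℝ) : ℝ :=
  ∫ θ in (0 : ℝ)..(2 * Real.pi), -(Real.cos θ * Real.sin (t * Real.cos θ))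

/-- The second derivative of `besselM`. -/
noncomputable def besselM'' (t : ℝ) : ℝ :=
  ∫ θ in (0 : ℝ)..(2 * Real.pi), -(Real.cos θ ^ 2 * Real.cos (t * Real.cos θ))

theorem hasDerivAt_besselM (t : ℝ) : HasDerivAt besselM (besselM' t) t := by
  refine (intervalIntegral.hasDerivAt_integral_of_dominated_loc_of_deriv_le
    (F := fun t θ => Real.cos (t * Real.cos θ))
    (F' := fun t θ => -(Real.cos θ * Real.sin (t * Real.cos θ)))
    (bound := fun _ => 1) (s := Set.univ) Filter.univ_mem ?_ ?_ ?_ ?_ ?_ ?_).2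
  · exact Eventually.of_forall fun x => (by fun_prop : Continuous _).aestronglyMeasurable
  · exact (by fun_prop : Continuous _).intervalIntegrable _ _
  · exact (by fun_prop : Continuous _).aestronglyMeasurable
  · refine Eventually.of_forall fun θ _ x _ => ?_
    rw [norm_neg, norm_mul]
    exact mul_le_one₀ (Real.abs_cos_le_one _) (norm_nonneg _) (Real.abs_sin_le_one _)
  · exact intervalIntegrable_const
  · refine Eventually.of_forall fun θ _ x _ => ?_
    have h := (Real.hasDerivAt_cos (x * Real.cos θ)).comp x
      ((hasDerivAt_id x).mul_const (Real.cos θ))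
    refine HasDerivAt.congr_deriv h ?_
    ring

theorem hasDerivAt_besselM' (t : ℝ) : HasDerivAt besselM' (besselM'' t) t := by
  refine (intervalIntegral.hasDerivAt_integral_of_dominated_loc_of_deriv_le
    (F := fun t θ => -(Real.cos θ * Real.sin (t * Real.cos θ)))
    (F' := fun t θ => -(Real.cos θ ^ 2 * Real.cos (t * Real.cos θ)))
    (bound := fun _ => 1) (s := Set.univ) Filter.univ_mem ?_ ?_ ?_ ?_ ?_ ?_).2
  · exact Eventually.of_forall fun x => (by fun_prop : Continuous _).aestronglyMeasurable
  · exact (by fun_prop : Continuous _).intervalIntegrable _ _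
  · exact (by fun_prop : Continuous _).aestronglyMeasurable
  · refine Eventually.of_forall fun θ _ x _ => ?_
    rw [norm_neg, norm_mul, norm_pow]
    exact mul_le_one₀ (pow_le_one₀ (norm_nonneg _) (Real.abs_cos_le_one _)) (norm_nonneg _)
      (Real.abs_cos_le_one _)
  · exact intervalIntegrable_const
  · refine Eventually.of_forall fun θ _ x _ => ?_
    have h := (((Real.hasDerivAt_sin (x * Real.cos θ)).comp x
      ((hasDerivAt_id x).mul_const (Real.cos θ))).const_mul (Real.cos θ)).neg
    refine HasDerivAt.congr_deriv h ?_
    ring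

/-- Bessel's differential equation of order zero. -/
theorem besselM_ode (t : ℝ) : t * besselM'' t + besselM' t + t * besselM t = 0 := by
  -- The left side is the integral of the derivative of a `2π`-periodic function of `θ`.
  have key : ∫ θ in (0 : ℝ)..(2 * Real.pi),
      (t * -(Real.cos θ ^ 2 * Real.cos (t * Real.cos θ)) +
        -(Real.cos θ * Real.sin (t * Real.cos θ)) + t * Real.cos (t * Real.cos θ)) = 0 := by
    rw [intervalIntegral.integral_eq_sub_of_hasDerivAt
      (f := fun θ => -(Real.sin θ * Real.sin (t * Real.cos θ)))]
    · simp
    · intro θ _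
      have h := ((Real.hasDerivAt_sin θ).mul ((Real.hasDerivAt_sin (t * Real.cos θ)).comp θ
        ((Real.hasDerivAt_cos θ).const_mul t))).neg
      refine HasDerivAt.congr_deriv h ?_
      simp only [Function.comp]
      linear_combination (t * Real.cos (t * Real.cos θ)) * Real.sin_sq_add_cos_sq θ
    · exact (by fun_prop : Continuous _).intervalIntegrable _ _
  rw [intervalIntegral.integral_add, intervalIntegral.integral_add,
    intervalIntegral.integral_const_mul, intervalIntegral.integral_const_mul] at key
  · exact key
  all_goals exact (by fun_prop : Continuous _).intervalIntegrable _ _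

theorem continuous_besselM : Continuous besselM :=
  continuous_iff_continuousAt.2 fun t => (hasDerivAt_besselM t).continuousAt

theorem continuous_besselM' : Continuous besselM' :=
  continuous_iff_continuousAt.2 fun t => (hasDerivAt_besselM' t).continuousAt

theorem besselM_pos {t : ℝ} (h0 : 0 ≤ t) (h1 : t ≤ 1) : 0 < besselM t := by
  refine intervalIntegral.intervalIntegral_pos_of_pos
    ((by fun_prop : Continuous _).intervalIntegrable _ _) (fun θ => ?_) (by positivity)
  have h2 : |t * Real.cos θ| ≤ 1 := by
    rw [abs_mul, abs_of_nonneg h0]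
    exact mul_le_one₀ h1 (abs_nonneg _) (Real.abs_cos_le_one _)
  exact Real.cos_pos_of_le_one h2

/-- An energy of the solution `besselM`, almost conserved for large `t`. -/
noncomputable def besselEnergy (t : ℝ) : ℝ :=
  t * (besselM t ^ 2 + besselM' t ^ 2) + besselM t * besselM' t

theorem hasDerivAt_besselEnergy {t : ℝ} (ht : t ≠ 0) :
    HasDerivAt besselEnergy (-(besselM t * besselM' t) / t) t := by
  have h := ((hasDerivAt_id t).mul (((hasDerivAt_besselM t).pow 2).add
    ((hasDerivAt_besselM' t).pow 2))).add ((hasDerivAt_besselM t).mul (hasDerivAt_besselM' t))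
  refine HasDerivAt.congr_deriv h ?_
  have ode := besselM_ode t
  simp only [id, Pi.add_apply, Pi.pow_apply]
  field_simp
  push_cast
  linear_combination (2 * t * besselM' t + besselM t) * ode

theorem sq_add_sq_le_besselEnergy (t : ℝ) :
    (t - 1 / 2) * (besselM t ^ 2 + besselM' t ^ 2) ≤ besselEnergy t := by
  unfold besselEnergy
  nlinarith [sq_nonneg (besselM t + besselM' t)]

theorem abs_besselM_mul_le {t : ℝ} (ht : 1 ≤ t) :
    t * |besselM t * besselM' t| ≤ besselEnergy t := by
  have h1 := sq_add_sq_le_besselEnergy t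
  have h2 : |besselM t * besselM' t| ≤ (besselM t ^ 2 + besselM' t ^ 2) / 2 := by
    rw [abs_le]
    constructor <;> nlinarith [sq_nonneg (besselM t + besselM' t),
      sq_nonneg (besselM t - besselM' t)]
  have h3 : 0 ≤ besselM t ^ 2 + besselM' t ^ 2 := by positivity
  nlinarith

theorem besselEnergy_one_pos : 0 < besselEnergy 1 := by
  have h := sq_add_sq_le_besselEnergy 1
  have := besselM_pos zero_le_one le_rfl
  nlinarith [sq_nonneg (besselM' 1), pow_pos this 2]

theorem monotoneOn_besselEnergy_mul_exp :
    MonotoneOn (fun t => besselEnergy t * Real.exp (-t⁻¹)) (Ici 1) := by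
  have hd : ∀ t : ℝ, 1 ≤ t → HasDerivAt (fun t => besselEnergy t * Real.exp (-t⁻¹))
      ((-(besselM t * besselM' t) / t + besselEnergy t / t ^ 2) * Real.exp (-t⁻¹)) t := by
    intro t ht
    have ht0 : t ≠ 0 := by positivity
    have h := (hasDerivAt_besselEnergy ht0).mul ((hasDerivAt_inv ht0).neg.exp)
    refine HasDerivAt.congr_deriv h ?_
    simp only [neg_neg, Pi.neg_apply]
    ring
  refine monotoneOn_of_deriv_nonneg (convex_Ici 1)
    (fun t ht => (hd t ht).continuousAt.continuousWithinAt)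
    (fun t ht => (hd t (interior_subset ht)).differentiableAt.differentiableWithinAt) ?_
  intro t ht
  have ht := interior_subset ht
  have ht : 1 ≤ t := ht
  rw [(hd t ht).deriv]
  refine mul_nonneg ?_ (Real.exp_pos _).le
  have h := abs_besselM_mul_le ht
  have h' := le_abs_self (besselM t * besselM' t)
  have : -(besselM t * besselM' t) / t + besselEnergy t / t ^ 2
      = (besselEnergy t - t * (besselM t * besselM' t)) / t ^ 2 := by
    field_simp
    ring
  rw [this]
  exact div_nonneg (by nlinarith) (by positivity)

theorem antitoneOn_besselEnergy_mul_exp :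
    AntitoneOn (fun t => besselEnergy t * Real.exp (t⁻¹)) (Ici 1) := by
  have hd : ∀ t : ℝ, 1 ≤ t → HasDerivAt (fun t => besselEnergy t * Real.exp (t⁻¹))
      ((-(besselM t * besselM' t) / t - besselEnergy t / t ^ 2) * Real.exp (t⁻¹)) t := by
    intro t ht
    have ht0 : t ≠ 0 := by positivity
    have h := (hasDerivAt_besselEnergy ht0).mul ((hasDerivAt_inv ht0).exp)
    refine HasDerivAt.congr_deriv h ?_
    ring
  refine antitoneOn_of_deriv_nonpos (convex_Ici 1)
    (fun t ht => (hd t ht).continuousAt.continuousWithinAt)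
    (fun t ht => (hd t (interior_subset ht)).differentiableAt.differentiableWithinAt) ?_
  intro t ht
  have ht := interior_subset ht
  have ht : 1 ≤ t := ht
  rw [(hd t ht).deriv]
  refine mul_nonpos_of_nonpos_of_nonneg ?_ (Real.exp_pos _).le
  have h := abs_besselM_mul_le ht
  have h' := neg_abs_le (besselM t * besselM' t)
  have : -(besselM t * besselM' t) / t - besselEnergy t / t ^ 2
      = -((besselEnergy t + t * (besselM t * besselM' t)) / t ^ 2) := by
    field_simp
    ring
  rw [this]
  exact neg_nonpos.2 (div_nonneg (by nlinarith) (by positivity))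

theorem exp_neg_one_mul_le_besselEnergy {t : ℝ} (ht : 1 ≤ t) :
    besselEnergy 1 * Real.exp (-1) ≤ besselEnergy t := by
  have h := monotoneOn_besselEnergy_mul_exp (mem_Ici.2 le_rfl) (mem_Ici.2 ht) ht
  simp only [inv_one] at h
  refine h.trans ?_
  have h0 : 0 ≤ besselEnergy t := (by positivity : (0:ℝ) ≤ _).trans (abs_besselM_mul_le ht)
  refine mul_le_of_le_one_right h0 (Real.exp_le_one_iff.2 ?_)
  simp only [Left.neg_nonpos_iff]
  positivity

theorem besselEnergy_le {t : ℝ} (ht : 1 ≤ t) :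
    besselEnergy t ≤ besselEnergy 1 * Real.exp 1 := by
  have h := antitoneOn_besselEnergy_mul_exp (mem_Ici.2 le_rfl) (mem_Ici.2 ht) ht
  simp only [inv_one] at h
  refine le_trans ?_ h
  have h0 : 0 ≤ besselEnergy t := (by positivity : (0:ℝ) ≤ _).trans (abs_besselM_mul_le ht)
  exact le_mul_of_one_le_right h0 (Real.one_le_exp (by positivity))

theorem sq_add_sq_ge {t : ℝ} (ht : 1 ≤ t) :
    besselEnergy 1 * Real.exp (-1) / 2 ≤ t * (besselM t ^ 2 + besselM' t ^ 2) := by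
  have h1 := exp_neg_one_mul_le_besselEnergy ht
  have h2 : besselEnergy t ≤ 2 * (t * (besselM t ^ 2 + besselM' t ^ 2)) := by
    unfold besselEnergy
    nlinarith [sq_nonneg (besselM t - besselM' t), sq_nonneg (besselM t), sq_nonneg (besselM' t)]
  linarith

theorem hasDerivAt_mul_besselM_mul (t : ℝ) :
    HasDerivAt (fun t => t * (besselM t * besselM' t))
      (t * (besselM' t ^ 2 - besselM t ^ 2)) t := by
  have h := (hasDerivAt_id t).mul ((hasDerivAt_besselM t).mul (hasDerivAt_besselM' t))
  refine HasDerivAt.congr_deriv h ?_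
  have ode := besselM_ode t
  simp only [id, Pi.mul_apply]
  linear_combination (besselM t) * ode

/-- The mean of `t * besselM t ^ 2` over long intervals is bounded below: the difference of
`t * besselM t ^ 2` and `t * besselM' t ^ 2` is the derivative of a bounded function, and their sum
is bounded below. -/
theorem integral_mul_besselM_sq_ge {a b : ℝ} (ha : 1 ≤ a) (hab : a ≤ b) :
    besselEnergy 1 * Real.exp (-1) / 4 * (b - a) - besselEnergy 1 * Real.exp 1 ≤
      ∫ t in a..b, t * besselM t ^ 2 := by
  have c0 := continuous_besselM
  have c1 := continuous_besselM'
  have h1 : ∫ t in a..b, t * (besselM' t ^ 2 - besselM t ^ 2) =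
      b * (besselM b * besselM' b) - a * (besselM a * besselM' a) :=
    intervalIntegral.integral_eq_sub_of_hasDerivAt (fun t _ => hasDerivAt_mul_besselM_mul t)
      ((by fun_prop : Continuous _).intervalIntegrable _ _)
  have h2 : ∫ t in a..b, besselEnergy 1 * Real.exp (-1) / 2 ≤
      ∫ t in a..b, t * (besselM t ^ 2 + besselM' t ^ 2) :=
    intervalIntegral.integral_mono_on hab intervalIntegrable_const
      ((by fun_prop : Continuous _).intervalIntegrable _ _)
      (fun t ht => sq_add_sq_ge (ha.trans ht.1))
  rw [intervalIntegral.integral_const, smul_eq_mul] at h2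
  have h3 : 2 * ∫ t in a..b, t * besselM t ^ 2 =
      (∫ t in a..b, t * (besselM t ^ 2 + besselM' t ^ 2)) -
        ∫ t in a..b, t * (besselM' t ^ 2 - besselM t ^ 2) := by
    rw [← intervalIntegral.integral_sub, ← intervalIntegral.integral_const_mul]
    · congr 1
      ext t
      ring
    all_goals exact (by fun_prop : Continuous _).intervalIntegrable _ _
  have ha' := abs_besselM_mul_le ha
  have hb' := abs_besselM_mul_le (ha.trans hab)
  have ea := besselEnergy_le ha
  have eb := besselEnergy_le (ha.trans hab)
  have ha2 : -(a * (besselM a * besselM' a)) ≤ a * |besselM a * besselM' a| := by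
    nlinarith [neg_abs_le (besselM a * besselM' a)]
  have hb2 : b * (besselM b * besselM' b) ≤ b * |besselM b * besselM' b| := by
    nlinarith [le_abs_self (besselM b * besselM' b)]
  linarith

theorem integral_besselM_sq_pos {a : ℝ} (ha : 0 ≤ a) :
    0 < ∫ r in (4 / 5 : ℝ)..1, besselM (a * r) ^ 2 := by
  have c0 := continuous_besselM
  rcases ha.eq_or_lt with rfl | ha0
  · have := besselM_pos le_rfl zero_le_one
    simp only [zero_mul, intervalIntegral.integral_const, smul_eq_mul]
    norm_num
    positivity
  by_contra hneg
  -- A vanishing integral forces `besselM` to vanish on an interval, hence its derivative too.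
  have hz : ∀ r ∈ Ioo (4 / 5 : ℝ) 1, besselM (a * r) = 0 := by
    intro r hr
    by_contra hne
    refine hneg (intervalIntegral.integral_pos (by norm_num)
      (by fun_prop : Continuous _).continuousOn (fun _ _ => sq_nonneg _)
      ⟨r, ⟨hr.1.le, hr.2.le⟩, by positivity⟩)
  have hz' : ∀ t ∈ Ioo (a * (4 / 5)) a, besselM t = 0 := by
    intro t ht
    have := hz (t / a) ⟨by rw [lt_div_iff₀ ha0]; linarith [ht.1],
      by rw [div_lt_one ha0]; exact ht.2⟩
    rwa [mul_div_cancel₀ _ ha0.ne'] at this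
  set t := a * (9 / 10) with ht
  have htm : t ∈ Ioo (a * (4 / 5)) a := ⟨by rw [ht]; linarith, by rw [ht]; linarith⟩
  have h0 := hz' t htm
  have h1 : besselM' t = 0 := by
    have hev : besselM =ᶠ[𝓝 t] fun _ => 0 := by
      filter_upwards [isOpen_Ioo.mem_nhds htm] with u hu using hz' u hu
    exact (hasDerivAt_besselM t).unique ((hasDerivAt_const t (0 : ℝ)).congr_of_eventuallyEq hev)
  rcases le_total t 1 with h | h
  · exact (besselM_pos (by positivity) h).ne' h0
  · have := sq_add_sq_ge h
    rw [h0, h1] at this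
    have := mul_pos besselEnergy_one_pos (Real.exp_pos (-1))
    norm_num at *
    linarith

/-- A lower bound, of the correct order `1 / (1 + a)`, for the mean square of `besselM` over
`[4a/5, a]`. -/
theorem exists_le_integral_besselM_sq :
    ∃ c : ℝ, 0 < c ∧ ∀ a : ℝ, 0 ≤ a →
      c ≤ (1 + a) * ∫ r in (4 / 5 : ℝ)..1, besselM (a * r) ^ 2 := by
  have c0 := continuous_besselM
  obtain ⟨k, hk0, hk⟩ : ∃ k, k = besselEnergy 1 * Real.exp (-1) / 4 ∧ 0 < k :=
    ⟨_, rfl, by have := besselEnergy_one_pos; positivity⟩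
  obtain ⟨K, hK0, hK⟩ : ∃ K, K = besselEnergy 1 * Real.exp 1 ∧ 0 < K :=
    ⟨_, rfl, by have := besselEnergy_one_pos; positivity⟩
  -- From `A` on, the boundary term `K` is at most half of the main term `k * (a / 5)`.
  set A : ℝ := 10 * K / k + 2 with hA
  have hA0 : 0 ≤ A := by positivity
  have hcont : Continuous fun a : ℝ => (1 + a) * ∫ r in (4 / 5 : ℝ)..1, besselM (a * r) ^ 2 := by
    refine Continuous.mul (by fun_prop) ?_
    exact intervalIntegral.continuous_parametric_intervalIntegral_of_continuous' (by fun_prop) _ _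
  obtain ⟨x, hx, hmin⟩ := isCompact_Icc.exists_isMinOn (nonempty_Icc.2 hA0) hcont.continuousOn
  have hxpos : 0 < (1 + x) * ∫ r in (4 / 5 : ℝ)..1, besselM (x * r) ^ 2 :=
    mul_pos (by linarith [hx.1]) (integral_besselM_sq_pos hx.1)
  refine ⟨min (k / 10) _, lt_min (by positivity) hxpos, fun a ha => ?_⟩
  rcases le_total a A with h | h
  · exact (min_le_right _ _).trans (hmin ⟨ha, h⟩)
  refine (min_le_left _ _).trans ?_
  have ha2 : 2 ≤ a := by
    have : 0 ≤ 10 * K / k := by positivity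
    linarith
  have hKa : K ≤ k * a / 10 := by
    have : 10 * K / k ≤ a := by linarith
    rw [div_le_iff₀ hk] at this
    linarith
  have h1 := integral_mul_besselM_sq_ge (a := a * (4 / 5)) (b := a * 1) (by linarith) (by linarith)
  rw [← hk0, ← hK0,
    ← intervalIntegral.mul_integral_comp_mul_left (f := fun t => t * besselM t ^ 2)] at h1
  have h2 : ∫ r in (4 / 5 : ℝ)..1, a * r * besselM (a * r) ^ 2 ≤
      ∫ r in (4 / 5 : ℝ)..1, a * besselM (a * r) ^ 2 := by
    refine intervalIntegral.integral_mono_on (by norm_num)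
      ((by fun_prop : Continuous _).intervalIntegrable _ _)
      ((by fun_prop : Continuous _).intervalIntegrable _ _) (fun r hr => ?_)
    have : a * r ≤ a := mul_le_of_le_one_right ha hr.2
    gcongr
  rw [intervalIntegral.integral_const_mul] at h2
  set I := ∫ r in (4 / 5 : ℝ)..1, besselM (a * r) ^ 2
  have hI : 0 < I := integral_besselM_sq_pos ha
  have h3 : k * a / 10 ≤ a * (a * I) := by
    have := mul_le_mul_of_nonneg_left h2 ha
    nlinarith
  have h4 : k / 10 ≤ a * I := by
    have ha0 : 0 < a := by linarith
    nlinarith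
  linarith

/-! ### Parseval's identity on the two-dimensional torus -/

/-- The character `x ↦ exp (i x)` of the real line. -/
noncomputable def expi (x : ℝ) : ℂ := Complex.exp (x * Complex.I)

theorem expi_add (x y : ℝ) : expi (x + y) = expi x * expi y := by
  simp [expi, add_mul, Complex.exp_add]

@[simp] theorem norm_expi (x : ℝ) : ‖expi x‖ = 1 := Complex.norm_exp_ofReal_mul_I x

@[simp] theorem expi_zero : expi 0 = 1 := by simp [expi]

theorem re_expi (x : ℝ) : (expi x).re = Real.cos x := Complex.exp_ofReal_mul_I_re x

theorem conj_expi (x : ℝ) : (starRingEnd ℂ) (expi x) = expi (-x) := by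
  simp [expi, ← Complex.exp_conj]

@[fun_prop] theorem continuous_expi : Continuous expi := by
  unfold expi; fun_prop

@[fun_prop] theorem measurable_expi : Measurable expi := continuous_expi.measurable

/-- Lebesgue measure on the square `[-π, π]²` of frequencies. -/
noncomputable def torusMeasure : Measure (ℝ × ℝ) :=
  (volume.restrict (Ioc (-Real.pi) Real.pi)).prod (volume.restrict (Ioc (-Real.pi) Real.pi))

/-- Lebesgue measure on the unit square of offsets. -/
noncomputable def offsetMeasure : Measure (ℝ × ℝ) :=
  (volume.restrict (Ioc (0 : ℝ) 1)).prod (volume.restrict (Ioc (0 : ℝ) 1))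

instance : IsFiniteMeasure torusMeasure := by unfold torusMeasure; infer_instance

instance : IsProbabilityMeasure offsetMeasure := by
  have : IsProbabilityMeasure (volume.restrict (Ioc (0 : ℝ) 1)) := ⟨by simp⟩
  unfold offsetMeasure; infer_instance

theorem integrable_of_norm_le_const {α E : Type*} [MeasurableSpace α] [NormedAddCommGroup E]
    [SecondCountableTopology E] [MeasurableSpace E] [BorelSpace E] {μ : Measure α}
    [IsFiniteMeasure μ] {f : α → E} (hf : Measurable f) (C : ℝ) (h : ∀ x, ‖f x‖ ≤ C) :
    Integrable f μ :=
  (integrable_const C).mono' hf.aestronglyMeasurable (Eventually.of_forall h)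

theorem integral_expi_int_mul (n : ℤ) :
    ∫ x in Ioc (-Real.pi) Real.pi, expi (n * x) = if n = 0 then ((2 * Real.pi : ℝ) : ℂ) else 0 := by
  rw [← intervalIntegral.integral_of_le (by linarith [Real.pi_pos])]
  split_ifs with h
  · simp only [h, Int.cast_zero, zero_mul, expi_zero, intervalIntegral.integral_const]
    rw [Complex.real_smul, mul_one]
    congr 1
    ring
  · have hn : (n : ℂ) * Complex.I ≠ 0 := by simp [h]
    have h1 : ∀ x : ℝ, expi (n * x) = Complex.exp (n * Complex.I * x) := by
      intro x
      simp only [expi]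
      congr 1
      push_cast
      ring
    simp_rw [h1]
    rw [integral_exp_mul_complex hn, div_eq_zero_iff]
    left
    rw [sub_eq_zero, Complex.exp_eq_exp_iff_exists_int]
    refine ⟨n, ?_⟩
    push_cast
    ring

theorem integral_torus_expi (m : ℤ × ℤ) :
    ∫ x, expi (m.1 * x.1 + m.2 * x.2) ∂torusMeasure =
      if m = 0 then (((2 * Real.pi) ^ 2 : ℝ) : ℂ) else 0 := by
  simp_rw [expi_add]
  rw [torusMeasure, integral_prod_mul (fun x => expi (m.1 * x)) (fun x => expi (m.2 * x)),
    integral_expi_int_mul, integral_expi_int_mul]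
  rcases m with ⟨a, b⟩
  by_cases ha : a = 0 <;> by_cases hb : b = 0 <;> simp [ha, hb, sq]

/-- Parseval's identity for trigonometric polynomials in two variables. -/
theorem integral_torus_norm_sq (s : Finset (ℤ × ℤ)) (c : ℤ × ℤ → ℝ) :
    ∫ x, ‖∑ n ∈ s, (c n : ℂ) * expi (-(n.1 * x.1 + n.2 * x.2))‖ ^ 2 ∂torusMeasure =
      (2 * Real.pi) ^ 2 * ∑ n ∈ s, c n ^ 2 := by
  have h1 : ∀ x : ℝ × ℝ,
      ((‖∑ n ∈ s, (c n : ℂ) * expi (-(n.1 * x.1 + n.2 * x.2))‖ ^ 2 : ℝ) : ℂ) =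
      ∑ n ∈ s, ∑ m ∈ s, (c n * c m : ℂ) *
        expi (((m - n).1 : ℤ) * x.1 + ((m - n).2 : ℤ) * x.2) := by
    intro x
    push_cast
    rw [← Complex.mul_conj', map_sum, Finset.sum_mul_sum]
    refine Finset.sum_congr rfl fun n _ => Finset.sum_congr rfl fun m _ => ?_
    rw [map_mul, Complex.conj_ofReal, conj_expi, mul_mul_mul_comm, ← expi_add]
    congr 2
    simp only [Prod.fst_sub, Prod.snd_sub]
    push_cast
    ring
  have hint : ∀ m : ℤ × ℤ, Integrable (fun x : ℝ × ℝ => expi (m.1 * x.1 + m.2 * x.2))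
      torusMeasure := fun m =>
    integrable_of_norm_le_const (by fun_prop) 1 (fun x => (norm_expi _).le)
  apply Complex.ofReal_injective
  rw [← integral_complex_ofReal]
  simp_rw [h1]
  rw [integral_finsetSum _ fun n _ => integrable_finsetSum _ fun m _ => (hint _).const_mul _]
  have h2 : ∀ n ∈ s, ∫ x, ∑ m ∈ s, (c n * c m : ℂ) *
        expi (((m - n).1 : ℤ) * x.1 + ((m - n).2 : ℤ) * x.2) ∂torusMeasure =
      (((2 * Real.pi) ^ 2 * c n ^ 2 : ℝ) : ℂ) := by
    intro n hn
    rw [integral_finsetSum _ fun m _ => (hint _).const_mul _]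
    simp_rw [integral_const_mul, integral_torus_expi, sub_eq_zero]
    rw [Finset.sum_eq_single n (fun m _ hm => by simp [hm]) (fun h => absurd hn h)]
    simp only [if_true]
    push_cast
    ring
  rw [Finset.sum_congr rfl h2, Finset.mul_sum]
  push_cast
  rfl

/-! ### The Fourier transform of arc length and of the unit cell -/

/-- The Fourier transform of the indicator function of the unit interval. -/
noncomputable def unitTransform (s : ℝ) : ℂ := ∫ z in (0 : ℝ)..1, expi (-(z * s))

theorem half_le_norm_unitTransform {s : ℝ} (hs : |s| ≤ Real.pi) : 1 / 2 ≤ ‖unitTransform s‖ := by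
  -- Recentring at `1 / 2` bounds the real part of the integrand below by
  -- `1 - ((1 / 2 - z) * s)² / 2`, which has mean `1 - s² / 24`.
  have h1 : expi (s / 2) * unitTransform s = ∫ z in (0 : ℝ)..1, expi ((1 / 2 - z) * s) := by
    rw [unitTransform, ← intervalIntegral.integral_const_mul]
    congr 1
    ext z
    rw [← expi_add]
    congr 1
    ring
  have h2 : (∫ z in (0 : ℝ)..1, expi ((1 / 2 - z) * s)).re =
      ∫ z in (0 : ℝ)..1, Real.cos ((1 / 2 - z) * s) := by
    have := Complex.reCLM.intervalIntegral_comp_comm (a := 0) (b := 1) (μ := volume)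
      (f := fun z : ℝ => expi ((1 / 2 - z) * s)) ((by fun_prop : Continuous _).intervalIntegrable _ _)
    simp only [Complex.reCLM_apply, re_expi] at this
    exact this.symm
  have h3 : ∫ z in (0 : ℝ)..1, (1 - ((1 / 2 - z) * s) ^ 2 / 2) ≤
      ∫ z in (0 : ℝ)..1, Real.cos ((1 / 2 - z) * s) :=
    intervalIntegral.integral_mono_on zero_le_one
      ((by fun_prop : Continuous _).intervalIntegrable _ _)
      ((by fun_prop : Continuous _).intervalIntegrable _ _)
      (fun z _ => Real.one_sub_sq_div_two_le_cos)
  have h4 : ∫ z in (0 : ℝ)..1, (1 - ((1 / 2 - z) * s) ^ 2 / 2) = 1 - s ^ 2 / 24 := by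
    rw [intervalIntegral.integral_eq_sub_of_hasDerivAt
      (f := fun z => z + s ^ 2 * (1 / 2 - z) ^ 3 / 6)]
    · norm_num
      ring
    · intro z _
      have h := (hasDerivAt_id z).add ((((((hasDerivAt_id z).const_sub (1 / 2)).pow 3).const_mul
        (s ^ 2))).div_const 6)
      refine HasDerivAt.congr_deriv h ?_
      simp only [id]
      push_cast
      ring
    · exact (by fun_prop : Continuous _).intervalIntegrable _ _
  have h5 : s ^ 2 ≤ 12 := by
    have : s ^ 2 ≤ Real.pi ^ 2 := by
      rw [← sq_abs s]
      gcongr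
    nlinarith [Real.pi_lt_d2, Real.pi_pos]
  calc (1 / 2 : ℝ) ≤ (expi (s / 2) * unitTransform s).re := by rw [h1, h2]; linarith
    _ ≤ ‖expi (s / 2) * unitTransform s‖ := Complex.re_le_norm _
    _ = ‖unitTransform s‖ := by rw [norm_mul, norm_expi, one_mul]

theorem integral_expi_fract (v s : ℝ) :
    ∫ y in Ioc (0 : ℝ) 1, expi (-(Int.fract (y + v) * s)) = unitTransform s := by
  have hper : Function.Periodic (fun y : ℝ => expi (-(Int.fract y * s))) 1 := by
    intro y
    simp only [Int.fract_add_one]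
  rw [← intervalIntegral.integral_of_le zero_le_one,
    intervalIntegral.integral_comp_add_right (fun y => expi (-(Int.fract y * s))), zero_add,
    add_comm 1 v, hper.intervalIntegral_add_eq v 0, zero_add, unitTransform]
  refine intervalIntegral.integral_congr_ae ?_
  filter_upwards [compl_mem_ae_iff.2 (measure_singleton (1 : ℝ))] with y hy hy'
  rw [uIoc_of_le zero_le_one] at hy'
  rw [Int.fract_eq_self.2 ⟨hy'.1.le, lt_of_le_of_ne hy'.2 hy⟩]

theorem abs_besselM_le_norm_integral (R u v : ℝ) :
    |besselM (R * √(u ^ 2 + v ^ 2))| ≤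
      ‖∫ θ in (0 : ℝ)..(2 * Real.pi), expi (R * (Real.cos θ * u + Real.sin θ * v))‖ := by
  set z : ℂ := ⟨u, v⟩ with hz
  have hn : ‖z‖ = √(u ^ 2 + v ^ 2) := by
    rw [Complex.norm_eq_sqrt_sq_add_sq]
  have hu : u = ‖z‖ * Real.cos z.arg := (Complex.norm_mul_cos_arg z).symm
  have hv : v = ‖z‖ * Real.sin z.arg := (Complex.norm_mul_sin_arg z).symm
  have hre : (∫ θ in (0 : ℝ)..(2 * Real.pi),
      expi (R * (Real.cos θ * u + Real.sin θ * v))).re =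
      ∫ θ in (0 : ℝ)..(2 * Real.pi), Real.cos (R * (Real.cos θ * u + Real.sin θ * v)) := by
    have := Complex.reCLM.intervalIntegral_comp_comm (a := 0) (b := 2 * Real.pi) (μ := volume)
      (f := fun θ : ℝ => expi (R * (Real.cos θ * u + Real.sin θ * v)))
      ((by fun_prop : Continuous _).intervalIntegrable _ _)
    simp only [Complex.reCLM_apply, re_expi] at this
    exact this.symm
  have hper : Function.Periodic (fun θ => Real.cos (R * √(u ^ 2 + v ^ 2) * Real.cos θ))
      (2 * Real.pi) := by
    intro θ
    simp only [Real.cos_add_two_pi]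
  have hM : besselM (R * √(u ^ 2 + v ^ 2)) =
      ∫ θ in (0 : ℝ)..(2 * Real.pi), Real.cos (R * (Real.cos θ * u + Real.sin θ * v)) := by
    have h1 : ∀ θ, Real.cos (R * (Real.cos θ * u + Real.sin θ * v)) =
        Real.cos (R * √(u ^ 2 + v ^ 2) * Real.cos (θ + -z.arg)) := by
      intro θ
      rw [← hn, Real.cos_add, Real.cos_neg, Real.sin_neg]
      congr 1
      conv_lhs => rw [hu, hv]
      ring
    simp_rw [h1]
    rw [intervalIntegral.integral_comp_add_right
      (fun θ => Real.cos (R * √(u ^ 2 + v ^ 2) * Real.cos θ)), zero_add, add_comm (2 * Real.pi),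
      hper.intervalIntegral_add_eq (-z.arg) 0, zero_add, besselM]
  rw [hM, ← hre]
  exact Complex.abs_re_le_norm _

theorem norm_integral_sq_le {α : Type*} [MeasurableSpace α] {μ : Measure α}
    [IsProbabilityMeasure μ] {f : α → ℂ} (hf : Measurable f) (C : ℝ) (hC : ∀ x, ‖f x‖ ≤ C) :
    ‖∫ x, f x ∂μ‖ ^ 2 ≤ ∫ x, ‖f x‖ ^ 2 ∂μ := by
  refine ConvexOn.map_integral_le (g := fun z : ℂ => ‖z‖ ^ 2)
    (convexOn_univ_norm.pow (fun _ _ => norm_nonneg _) 2) (by fun_prop) isClosed_univ (by simp)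
    (integrable_of_norm_le_const hf C hC) ?_
  refine integrable_of_norm_le_const (by fun_prop) (C ^ 2) fun x => ?_
  simp only [Function.comp, norm_pow, norm_norm]
  exact pow_le_pow_left₀ (norm_nonneg _) (hC x) 2

/-- The Fourier transform, at frequency `ξ`, of the lattice shifts met by the circle of radius `R`
centered at `y`. -/
noncomputable def circleTransform (R : ℝ) (y ξ : ℝ × ℝ) : ℂ :=
  ∫ θ in Ioc (0 : ℝ) (2 * Real.pi),
    expi (⌊y.1 + R * Real.cos θ⌋ * ξ.1 + ⌊y.2 + R * Real.sin θ⌋ * ξ.2)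

theorem measurable_circleTransform :
    Measurable fun p : (ℝ × ℝ × ℝ) × (ℝ × ℝ) => circleTransform p.1.1 p.1.2 p.2 := by
  unfold circleTransform
  refine StronglyMeasurable.measurable ?_
  refine StronglyMeasurable.integral_prod_right (f := fun (p : (ℝ × ℝ × ℝ) × (ℝ × ℝ)) (θ : ℝ) =>
    expi (⌊p.1.2.1 + p.1.1 * Real.cos θ⌋ * p.2.1 + ⌊p.1.2.2 + p.1.1 * Real.sin θ⌋ * p.2.2)) ?_
  refine Measurable.stronglyMeasurable ?_
  have hcast : Measurable fun n : ℤ => (n : ℝ) := measurable_from_top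
  have h1 : Measurable fun q : ((ℝ × ℝ × ℝ) × (ℝ × ℝ)) × ℝ =>
      ((⌊q.1.1.2.1 + q.1.1.1 * Real.cos q.2⌋ : ℤ) : ℝ) :=
    hcast.comp (Measurable.floor (by fun_prop))
  have h2 : Measurable fun q : ((ℝ × ℝ × ℝ) × (ℝ × ℝ)) × ℝ =>
      ((⌊q.1.1.2.2 + q.1.1.1 * Real.sin q.2⌋ : ℤ) : ℝ) :=
    hcast.comp (Measurable.floor (by fun_prop))
  exact measurable_expi.comp ((h1.mul (by fun_prop)).add (h2.mul (by fun_prop)))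

theorem norm_circleTransform_le (R : ℝ) (y ξ : ℝ × ℝ) :
    ‖circleTransform R y ξ‖ ≤ 2 * Real.pi := by
  refine (norm_setIntegral_le_of_norm_le_const (C := 1)
    (by rw [Real.volume_Ioc]; exact ENNReal.ofReal_lt_top)
    (fun θ _ => (norm_expi _).le)).trans ?_
  simp [Real.pi_pos.le]

/-- Averaging over the offset `y` recovers the Fourier transform of arc length times that of the
unit cell, because `⌊t⌋ - y = v - fract t` for `t = y + v`, and `y ↦ fract (y + v)` is
equidistributed. -/
theorem integral_expi_mul_circleTransform (R : ℝ) (ξ : ℝ × ℝ) :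
    ∫ y, expi (-(y.1 * ξ.1 + y.2 * ξ.2)) * circleTransform R y ξ ∂offsetMeasure =
      (∫ θ in (0 : ℝ)..(2 * Real.pi), expi (R * (Real.cos θ * ξ.1 + Real.sin θ * ξ.2))) *
        (unitTransform ξ.1 * unitTransform ξ.2) := by
  have h1 : ∀ y : ℝ × ℝ, expi (-(y.1 * ξ.1 + y.2 * ξ.2)) * circleTransform R y ξ =
      ∫ θ in Ioc (0 : ℝ) (2 * Real.pi), expi (R * (Real.cos θ * ξ.1 + Real.sin θ * ξ.2)) *
        (expi (-(Int.fract (y.1 + R * Real.cos θ) * ξ.1)) *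
          expi (-(Int.fract (y.2 + R * Real.sin θ) * ξ.2))) := by
    intro y
    rw [circleTransform, ← integral_const_mul]
    congr 1
    ext θ
    simp only [← expi_add, Int.fract]
    congr 1
    ring
  simp_rw [h1]
  rw [integral_integral_swap]
  · rw [intervalIntegral.integral_of_le (by positivity), ← integral_mul_const]
    congr 1
    ext θ
    rw [integral_const_mul, offsetMeasure,
      integral_prod_mul (fun y => expi (-(Int.fract (y + R * Real.cos θ) * ξ.1)))
        (fun y => expi (-(Int.fract (y + R * Real.sin θ) * ξ.2))),
      integral_expi_fract, integral_expi_fract]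
  · refine integrable_of_norm_le_const ?_ 1 fun q => by
      simp only [Function.uncurry, norm_mul, norm_expi, mul_one, le_refl]
    have h1 : Measurable fun q : (ℝ × ℝ) × ℝ => Int.fract (q.1.1 + R * Real.cos q.2) :=
      measurable_fract.comp (by fun_prop)
    have h2 : Measurable fun q : (ℝ × ℝ) × ℝ => Int.fract (q.1.2 + R * Real.sin q.2) :=
      measurable_fract.comp (by fun_prop)
    refine Measurable.mul (measurable_expi.comp (by fun_prop)) (Measurable.mul ?_ ?_)
    · exact measurable_expi.comp (h1.mul_const _).neg
    · exact measurable_expi.comp (h2.mul_const _).neg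

theorem besselM_sq_le_integral_norm_circleTransform_sq (R : ℝ) {ξ : ℝ × ℝ}
    (h1 : |ξ.1| ≤ Real.pi) (h2 : |ξ.2| ≤ Real.pi) :
    besselM (R * √(ξ.1 ^ 2 + ξ.2 ^ 2)) ^ 2 / 16 ≤
      ∫ y, ‖circleTransform R y ξ‖ ^ 2 ∂offsetMeasure := by
  have hm : Measurable fun y => circleTransform R y ξ :=
    Measurable.comp
      (g := fun p : (ℝ × ℝ × ℝ) × (ℝ × ℝ) => circleTransform p.1.1 p.1.2 p.2)
      (f := fun y : ℝ × ℝ => ((R, y), ξ)) measurable_circleTransform (by fun_prop)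
  have he : Measurable fun y : ℝ × ℝ => expi (-(y.1 * ξ.1 + y.2 * ξ.2)) := by fun_prop
  have key := norm_integral_sq_le (μ := offsetMeasure)
    (f := fun y => expi (-(y.1 * ξ.1 + y.2 * ξ.2)) * circleTransform R y ξ)
    (he.mul hm) (2 * Real.pi) (fun y => by
      rw [norm_mul, norm_expi, one_mul]
      exact norm_circleTransform_le R y ξ)
  simp only [norm_mul, norm_expi, one_mul, integral_expi_mul_circleTransform] at key
  refine le_trans ?_ key
  have e1 := half_le_norm_unitTransform h1
  have e2 := half_le_norm_unitTransform h2
  have e3 := abs_besselM_le_norm_integral R ξ.1 ξ.2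
  have e4 := pow_le_pow_left₀ (by positivity) (mul_le_mul e3
    (mul_le_mul e1 e2 (by norm_num) (norm_nonneg _)) (by norm_num) (norm_nonneg _)) 2
  rw [mul_pow, sq_abs] at e4
  refine le_trans (le_of_eq ?_) e4
  ring

/-! ### Circle sums as convolutions on the lattice -/

/-- The integral over the angle, along the circle with center `x` and radius `R`, of the step
function equal to `a (i, j)` on the cell `(i, j) + [0,1)²`. -/
noncomputable def circleSum (a : ℤ × ℤ → ℝ) (R : ℝ) (x : ℝ × ℝ) : ℝ :=
  ∫ θ in Ioc (0 : ℝ) (2 * Real.pi), a (⌊x.1 + R * Real.cos θ⌋, ⌊x.2 + R * Real.sin θ⌋)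

/-- The lattice points that index the cells of the `N × N` board. -/
noncomputable def board (N : ℕ) : Finset (ℤ × ℤ) := Finset.Ico 0 (N : ℤ) ×ˢ Finset.Ico 0 (N : ℤ)

/-- A range of translates containing all those whose circles of radius at most `N / 4` meet the
board. -/
noncomputable def bigBoard (N : ℕ) : Finset (ℤ × ℤ) :=
  Finset.Ico (-(N : ℤ)) (2 * N) ×ˢ Finset.Ico (-(N : ℤ)) (2 * N)

/-- The trigonometric polynomial whose coefficients are the values on the board. -/
noncomputable def boardTransform (a : ℤ × ℤ → ℝ) (N : ℕ) (ξ : ℝ × ℝ) : ℂ :=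
  ∑ n ∈ board N, (a n : ℂ) * expi (-(n.1 * ξ.1 + n.2 * ξ.2))

theorem continuous_boardTransform (a : ℤ × ℤ → ℝ) (N : ℕ) : Continuous (boardTransform a N) := by
  unfold boardTransform
  fun_prop

theorem norm_boardTransform_le {a : ℤ × ℤ → ℝ} (ha : ∀ n, |a n| ≤ 1) (N : ℕ) (ξ : ℝ × ℝ) :
    ‖boardTransform a N ξ‖ ≤ (board N).card := by
  refine (norm_sum_le_of_le _ (fun n _ => ?_)).trans (b := ∑ _n ∈ board N, (1 : ℝ)) (by simp)
  rw [norm_mul, norm_expi, mul_one, Complex.norm_real]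
  exact ha n

/-- A translate of the board by a vector of size at most `N` stays within `bigBoard N`. -/
theorem sum_bigBoard_shift {a : ℤ × ℤ → ℝ} {N : ℕ} (ha : ∀ n ∉ board N, a n = 0) {k : ℤ × ℤ}
    (h1 : |k.1| ≤ N) (h2 : |k.2| ≤ N) (ξ : ℝ × ℝ) :
    ∑ n ∈ bigBoard N, (a (k + n) : ℂ) * expi (-(n.1 * ξ.1 + n.2 * ξ.2)) =
      boardTransform a N ξ * expi (k.1 * ξ.1 + k.2 * ξ.2) := by
  have hg : ∀ n : ℤ × ℤ, (a (k + n) : ℂ) * expi (-(n.1 * ξ.1 + n.2 * ξ.2)) =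
      (fun m : ℤ × ℤ => (a m : ℂ) * expi (-(m.1 * ξ.1 + m.2 * ξ.2)) *
        expi (k.1 * ξ.1 + k.2 * ξ.2)) (addLeftEmbedding k n) := by
    intro n
    simp only [addLeftEmbedding_apply, mul_assoc, ← expi_add, Prod.fst_add, Prod.snd_add]
    congr 2
    push_cast
    ring
  simp_rw [hg]
  rw [← Finset.sum_map (bigBoard N) (addLeftEmbedding k) (fun m : ℤ × ℤ =>
    (a m : ℂ) * expi (-(m.1 * ξ.1 + m.2 * ξ.2)) * expi (k.1 * ξ.1 + k.2 * ξ.2)),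
    boardTransform, Finset.sum_mul]
  symm
  refine Finset.sum_subset ?_ fun m _ hm => by simp [ha m hm]
  intro m hm
  rw [Finset.mem_map]
  refine ⟨m - k, ?_, by simp⟩
  rw [abs_le] at h1 h2
  simp only [board, bigBoard, Finset.mem_product, Finset.mem_Ico, Prod.fst_sub,
    Prod.snd_sub] at hm ⊢
  omega

theorem measurable_comp_floor_circle (a : ℤ × ℤ → ℝ) (R : ℝ) (x : ℝ × ℝ) :
    Measurable fun θ => a (⌊x.1 + R * Real.cos θ⌋, ⌊x.2 + R * Real.sin θ⌋) := by
  have ha : Measurable a := measurable_of_countable a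
  exact ha.comp ((Measurable.floor (by fun_prop)).prodMk (Measurable.floor (by fun_prop)))

theorem abs_floor_add_mul_le {N : ℕ} {R y c : ℝ} (hR0 : 0 ≤ R) (hR : R < N) (hy : y ∈ Ioc (0 : ℝ) 1)
    (hc : |c| ≤ 1) : |⌊y + R * c⌋| ≤ (N : ℤ) := by
  have h := abs_le.1 hc
  have h1 : -R ≤ R * c := by nlinarith
  have h2 : R * c ≤ R := by nlinarith
  rw [abs_le]
  constructor
  · rw [Int.le_floor]
    push_cast
    linarith [hy.1]
  · rw [← Int.lt_add_one_iff, Int.floor_lt]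
    push_cast
    linarith [hy.2]

/-- The convolution theorem on the lattice: for a fixed offset `y`, the circle sums centered at the
points of `y + ℤ²` have Fourier series `boardTransform * circleTransform`. -/
theorem sum_circleSum_mul_expi {a : ℤ × ℤ → ℝ} {N : ℕ} (ha : ∀ n ∉ board N, a n = 0)
    (ha1 : ∀ n, |a n| ≤ 1) {R : ℝ} (hR0 : 0 ≤ R) (hR : R < N) {y : ℝ × ℝ}
    (hy1 : y.1 ∈ Ioc (0 : ℝ) 1) (hy2 : y.2 ∈ Ioc (0 : ℝ) 1) (ξ : ℝ × ℝ) :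
    ∑ n ∈ bigBoard N, (circleSum a R (y.1 + n.1, y.2 + n.2) : ℂ) *
        expi (-(n.1 * ξ.1 + n.2 * ξ.2)) =
      boardTransform a N ξ * circleTransform R y ξ := by
  have h1 : ∀ n : ℤ × ℤ, (circleSum a R (y.1 + n.1, y.2 + n.2) : ℂ) *
      expi (-(n.1 * ξ.1 + n.2 * ξ.2)) = ∫ θ in Ioc (0 : ℝ) (2 * Real.pi),
        (a (⌊y.1 + n.1 + R * Real.cos θ⌋, ⌊y.2 + n.2 + R * Real.sin θ⌋) : ℂ) *
          expi (-(n.1 * ξ.1 + n.2 * ξ.2)) := by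
    intro n
    rw [integral_mul_const, circleSum, integral_complex_ofReal]
  simp_rw [h1]
  rw [← integral_finsetSum, circleTransform, ← integral_const_mul]
  · congr 1
    ext θ
    rw [← sum_bigBoard_shift ha (k := (⌊y.1 + R * Real.cos θ⌋, ⌊y.2 + R * Real.sin θ⌋))
      (abs_floor_add_mul_le hR0 hR hy1 (Real.abs_cos_le_one _))
      (abs_floor_add_mul_le hR0 hR hy2 (Real.abs_sin_le_one _))]
    refine Finset.sum_congr rfl fun n _ => ?_
    rw [add_right_comm, add_right_comm y.2, Int.floor_add_intCast, Int.floor_add_intCast]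
    rfl
  · intro n _
    refine Integrable.mul_const ?_ _
    refine integrable_of_norm_le_const ?_ 1 fun θ => ?_
    · exact Complex.measurable_ofReal.comp
        (measurable_comp_floor_circle a R (y.1 + n.1, y.2 + n.2))
    · rw [Complex.norm_real]
      exact ha1 _

theorem integral_boardTransform_mul_le {a : ℤ × ℤ → ℝ} {N : ℕ} (ha : ∀ n ∉ board N, a n = 0)
    (ha1 : ∀ n, |a n| ≤ 1) {R : ℝ} (hR0 : 0 ≤ R) (hR : R < N) {y : ℝ × ℝ}
    (hy1 : y.1 ∈ Ioc (0 : ℝ) 1) (hy2 : y.2 ∈ Ioc (0 : ℝ) 1) {D : ℝ}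
    (hD : ∀ x, |circleSum a R x| ≤ D) :
    ∫ ξ, ‖boardTransform a N ξ‖ ^ 2 * ‖circleTransform R y ξ‖ ^ 2 ∂torusMeasure ≤
      (2 * Real.pi) ^ 2 * (9 * N ^ 2 * D ^ 2) := by
  simp_rw [← mul_pow, ← norm_mul, ← sum_circleSum_mul_expi ha ha1 hR0 hR hy1 hy2]
  rw [integral_torus_norm_sq (bigBoard N) (fun n => circleSum a R (y.1 + n.1, y.2 + n.2))]
  gcongr
  calc ∑ n ∈ bigBoard N, circleSum a R (y.1 + n.1, y.2 + n.2) ^ 2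
      ≤ ∑ n ∈ bigBoard N, D ^ 2 := Finset.sum_le_sum fun n _ => sq_le_sq' (abs_le.1 (hD _)).1
        (abs_le.1 (hD _)).2
    _ = 9 * N ^ 2 * D ^ 2 := by
      have h3 : (2 * (N : ℤ) - -N).toNat = 3 * N := by omega
      rw [Finset.sum_const, nsmul_eq_mul, bigBoard, Finset.card_product, Int.card_Ico, h3]
      push_cast
      ring

theorem integral_boardTransform_sq {a : ℤ × ℤ → ℝ} {N : ℕ} (ha : ∀ n ∈ board N, a n ^ 2 = 1) :
    ∫ ξ, ‖boardTransform a N ξ‖ ^ 2 ∂torusMeasure = (2 * Real.pi) ^ 2 * N ^ 2 := by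
  unfold boardTransform
  rw [integral_torus_norm_sq, Finset.sum_congr rfl ha, Finset.sum_const, board,
    Finset.card_product, Int.card_Ico]
  simp [sq]

/-! ### The mean square of the circle sums -/

theorem exists_le_integral_besselM_radius :
    ∃ c : ℝ, 0 < c ∧ ∀ N : ℕ, 1 ≤ N → ∀ s : ℝ, 0 ≤ s → s ≤ 5 →
      c ≤ ∫ R in Ioo ((N : ℝ) / 5) (N / 4), besselM (R * s) ^ 2 := by
  obtain ⟨c, hc, h⟩ := exists_le_integral_besselM_sq
  refine ⟨c / 9, by positivity, fun N hN s hs0 hs => ?_⟩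
  have hN1 : (1 : ℝ) ≤ N := by exact_mod_cast hN
  rw [← integral_Ioc_eq_integral_Ioo, ← intervalIntegral.integral_of_le (by linarith)]
  have h1 := intervalIntegral.mul_integral_comp_mul_left (a := 4 / 5) (b := 1)
    (f := fun R => besselM (R * s) ^ 2) (N / 4 : ℝ)
  rw [show (N / 4 : ℝ) * (4 / 5) = N / 5 by ring, mul_one] at h1
  have h2 := h (N / 4 * s) (by positivity)
  have h3 : ∀ r : ℝ, (N : ℝ) / 4 * s * r = N / 4 * r * s := fun r => by ring
  simp_rw [h3] at h2
  rw [← h1]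
  set I := ∫ r in (4 / 5 : ℝ)..1, besselM (N / 4 * r * s) ^ 2
  have hI : 0 ≤ I := intervalIntegral.integral_nonneg (by norm_num) fun _ _ => sq_nonneg _
  have h4 : 1 + N / 4 * s ≤ 9 * (N / 4 : ℝ) := by nlinarith
  have h5 := mul_le_mul_of_nonneg_right h4 hI
  linarith

theorem ae_torusMeasure : ∀ᵐ ξ ∂torusMeasure, |ξ.1| ≤ Real.pi ∧ |ξ.2| ≤ Real.pi := by
  rw [torusMeasure, Measure.prod_restrict]
  filter_upwards [ae_restrict_mem (measurableSet_Ioc.prod measurableSet_Ioc)] with ξ hξ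
  exact ⟨abs_le.2 ⟨hξ.1.1.le, hξ.1.2⟩, abs_le.2 ⟨hξ.2.1.le, hξ.2.2⟩⟩

/-- The `L²` lower bound: if all circle sums with radius in `(N / 5, N / 4)` are at most `D`, then
`N * D ^ 2` is bounded below. -/
theorem exists_le_mul_sq_of_circleSum_le :
    ∃ c : ℝ, 0 < c ∧ ∀ N : ℕ, 1 ≤ N → ∀ a : ℤ × ℤ → ℝ,
      (∀ n ∉ board N, a n = 0) → (∀ n ∈ board N, a n ^ 2 = 1) → ∀ D : ℝ,
      (∀ R ∈ Ioo ((N : ℝ) / 5) (N / 4), ∀ x, |circleSum a R x| ≤ D) → c ≤ N * D ^ 2 := by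
  obtain ⟨c, hc, hbes⟩ := exists_le_integral_besselM_radius
  refine ⟨c / 16 * (20 / 9), by positivity, fun N hN a ha0 ha D hD => ?_⟩
  have hN1 : (1 : ℝ) ≤ N := by exact_mod_cast hN
  have ha1 : ∀ n, |a n| ≤ 1 := by
    intro n
    by_cases hn : n ∈ board N
    · exact (sq_le_one_iff_abs_le_one _).1 (ha n hn).le
    · simp [ha0 n hn]
  set J := Ioo ((N : ℝ) / 5) (N / 4) with hJ
  set μ : Measure (ℝ × ℝ × ℝ) := (volume.restrict J).prod offsetMeasure with hμ
  have hJfin : IsFiniteMeasure (volume.restrict J) := by rw [hJ]; infer_instance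
  have hmeas : Measurable fun p : (ℝ × ℝ × ℝ) × (ℝ × ℝ) =>
      ‖circleTransform p.1.1 p.1.2 p.2‖ ^ 2 := (measurable_circleTransform.norm).pow_const 2
  have hbound : ∀ R y ξ, ‖‖circleTransform R y ξ‖ ^ 2‖ ≤ (2 * Real.pi) ^ 2 := fun R y ξ => by
    rw [norm_pow, norm_norm]
    exact pow_le_pow_left₀ (norm_nonneg _) (norm_circleTransform_le R y ξ) 2
  have hmeasB : Measurable fun ξ => ‖boardTransform a N ξ‖ ^ 2 :=
    ((continuous_boardTransform a N).norm.pow 2).measurable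
  have hboundB : ∀ ξ, ‖‖boardTransform a N ξ‖ ^ 2‖ ≤ ((board N).card : ℝ) ^ 2 := fun ξ => by
    rw [norm_pow, norm_norm]
    exact pow_le_pow_left₀ (norm_nonneg _) (norm_boardTransform_le ha1 N ξ) 2
  have hint : Integrable (fun p : (ℝ × ℝ × ℝ) × (ℝ × ℝ) =>
      ‖boardTransform a N p.2‖ ^ 2 * ‖circleTransform p.1.1 p.1.2 p.2‖ ^ 2)
      (μ.prod torusMeasure) := by
    refine integrable_of_norm_le_const ((hmeasB.comp measurable_snd).mul hmeas)
      (((board N).card : ℝ) ^ 2 * (2 * Real.pi) ^ 2) fun p => ?_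
    rw [norm_mul]
    exact mul_le_mul (hboundB _) (hbound _ _ _) (norm_nonneg _) (by positivity)
  have hswap := integral_integral_swap (μ := μ) (ν := torusMeasure)
    (f := fun p ξ => ‖boardTransform a N ξ‖ ^ 2 * ‖circleTransform p.1 p.2 ξ‖ ^ 2) hint
  have hμae : ∀ᵐ p ∂μ, p.1 ∈ J ∧ p.2.1 ∈ Ioc (0 : ℝ) 1 ∧ p.2.2 ∈ Ioc (0 : ℝ) 1 := by
    rw [hμ, offsetMeasure, Measure.prod_restrict, Measure.prod_restrict]
    filter_upwards [ae_restrict_mem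
      (measurableSet_Ioo.prod (measurableSet_Ioc.prod measurableSet_Ioc))] with p hp
    exact ⟨hp.1, hp.2.1, hp.2.2⟩
  have hμreal : μ.real univ = N / 20 := by
    rw [hμ, ← univ_prod_univ, measureReal_prod_prod, measureReal_restrict_apply_univ, hJ,
      Real.volume_real_Ioo_of_le (by linarith), probReal_univ]
    ring
  have hupper : ∫ p, ∫ ξ, ‖boardTransform a N ξ‖ ^ 2 * ‖circleTransform p.1 p.2 ξ‖ ^ 2
      ∂torusMeasure ∂μ ≤ N / 20 * ((2 * Real.pi) ^ 2 * (9 * N ^ 2 * D ^ 2)) := by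
    refine (integral_mono_ae hint.integral_prod_left (integrable_const _) ?_).trans_eq
      (by rw [integral_const, smul_eq_mul, hμreal])
    filter_upwards [hμae] with p hp
    exact integral_boardTransform_mul_le ha0 ha1 (by linarith [hp.1.1]) (by linarith [hp.1.2])
      hp.2.1 hp.2.2 (hD p.1 hp.1)
  have hlower : c / 16 * ((2 * Real.pi) ^ 2 * N ^ 2) ≤
      ∫ ξ, ∫ p, ‖boardTransform a N ξ‖ ^ 2 * ‖circleTransform p.1 p.2 ξ‖ ^ 2 ∂μ ∂torusMeasure := by
    rw [← integral_boardTransform_sq ha, ← integral_const_mul]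
    refine integral_mono_ae ((integrable_of_norm_le_const hmeasB _ hboundB).const_mul _)
      hint.integral_prod_right ?_
    filter_upwards [ae_torusMeasure] with ξ hξ
    rw [integral_const_mul, mul_comm]
    refine mul_le_mul_of_nonneg_left ?_ (by positivity)
    have hξm : Measurable fun p : ℝ × ℝ × ℝ => ‖circleTransform p.1 p.2 ξ‖ ^ 2 :=
      Measurable.comp (g := fun p : (ℝ × ℝ × ℝ) × (ℝ × ℝ) =>
        ‖circleTransform p.1.1 p.1.2 p.2‖ ^ 2) (f := fun p => (p, ξ)) hmeas (by fun_prop)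
    have hξint : Integrable (fun p : ℝ × ℝ × ℝ => ‖circleTransform p.1 p.2 ξ‖ ^ 2) μ :=
      integrable_of_norm_le_const hξm _ fun p => hbound _ _ _
    rw [hμ, integral_prod _ hξint]
    have hs : √(ξ.1 ^ 2 + ξ.2 ^ 2) ≤ 5 := by
      rw [Real.sqrt_le_left (by norm_num), ← sq_abs ξ.1, ← sq_abs ξ.2]
      have h1 : |ξ.1| ≤ 3.15 := hξ.1.trans Real.pi_lt_d2.le
      have h2 : |ξ.2| ≤ 3.15 := hξ.2.trans Real.pi_lt_d2.le
      nlinarith [abs_nonneg ξ.1, abs_nonneg ξ.2]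
    have hB := hbes N hN _ (Real.sqrt_nonneg _) hs
    refine (div_le_div_of_nonneg_right hB (by norm_num : (0 : ℝ) ≤ 16)).trans ?_
    rw [← integral_div]
    refine integral_mono ?_ hξint.integral_prod_left fun R =>
      besselM_sq_le_integral_norm_circleTransform_sq R hξ.1 hξ.2
    have hcont : Continuous fun R => besselM (R * √(ξ.1 ^ 2 + ξ.2 ^ 2)) ^ 2 / 16 := by
      have := continuous_besselM
      fun_prop
    exact (hcont.integrableOn_Icc (a := (N : ℝ) / 5) (b := N / 4)).mono_set Ioo_subset_Icc_self
  rw [← hswap] at hlower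
  have hfin := hlower.trans hupper
  have hk : 0 < (2 * Real.pi) ^ 2 * (N : ℝ) ^ 2 := by positivity
  have : c / 16 * ((2 * Real.pi) ^ 2 * N ^ 2) ≤
      (9 / 20 * (N * D ^ 2)) * ((2 * Real.pi) ^ 2 * (N : ℝ) ^ 2) := by linarith
  have := le_of_mul_le_mul_right this hk
  linarith

/-! ### Colorings of the checkerboard -/

theorem countable_setOf_cos_eq (c : ℝ) : {θ : ℝ | Real.cos θ = c}.Countable := by
  by_cases h : ∃ φ, Real.cos φ = c
  · obtain ⟨φ, rfl⟩ := h
    refine ((countable_range fun k : ℤ => 2 * k * Real.pi + φ).union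
      (countable_range fun k : ℤ => 2 * k * Real.pi - φ)).mono fun θ hθ => ?_
    obtain ⟨k, hk | hk⟩ := Real.cos_eq_cos_iff.1 (mem_ofPred.1 hθ).symm
    · exact Or.inl ⟨k, hk.symm⟩
    · exact Or.inr ⟨k, hk.symm⟩
  · convert countable_empty (α := ℝ)
    ext θ
    simpa using fun hθ => h ⟨θ, hθ⟩

theorem ae_add_mul_cos_ne (x c : ℝ) {R : ℝ} (hR : R ≠ 0) :
    ∀ᵐ θ : ℝ, x + R * Real.cos θ ≠ c := by
  refine ((countable_setOf_cos_eq ((c - x) / R)).ae_notMem volume).mono fun θ hθ h => hθ ?_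
  rw [mem_ofPred, eq_div_iff hR]
  linarith

theorem ae_add_mul_sin_ne (x c : ℝ) {R : ℝ} (hR : R ≠ 0) :
    ∀ᵐ θ : ℝ, x + R * Real.sin θ ≠ c := by
  have hcount : {θ : ℝ | Real.sin θ = (c - x) / R}.Countable :=
    ((countable_setOf_cos_eq ((c - x) / R)).preimage
      (f := fun θ => Real.pi / 2 - θ) sub_right_injective).mono
      fun θ hθ => by simpa [Real.cos_pi_div_two_sub] using hθ
  refine (hcount.ae_notMem volume).mono fun θ hθ h => hθ ?_
  rw [mem_ofPred, eq_div_iff hR]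
  linarith

open CheckerboardDiscrepancy in
/-- The values of a coloring at the lower left corners of the cells. -/
noncomputable def cornerValue (N : ℕ) (f : Plane → ℝ) (n : ℤ × ℤ) : ℝ :=
  if n ∈ board N then f !₂[(n.1 : ℝ), (n.2 : ℝ)] else 0

open CheckerboardDiscrepancy in
theorem cornerValue_sq {N : ℕ} {f : Plane → ℝ} (hf : IsColoring N f) {n : ℤ × ℤ}
    (hn : n ∈ board N) : cornerValue N f n ^ 2 = 1 := by
  rw [cornerValue, if_pos hn]
  obtain ⟨i, j⟩ := n
  simp only [board, Finset.mem_product, Finset.mem_Ico] at hn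
  obtain ⟨⟨hi0, hi⟩, hj0, hj⟩ := hn
  lift i to ℕ using hi0
  lift j to ℕ using hj0
  obtain ⟨c, hc, h⟩ := hf.const_on_cell i (by exact_mod_cast hi) j (by exact_mod_cast hj)
  rw [h _ (by simp [cell])]
  rcases hc with rfl | rfl <;> norm_num

open CheckerboardDiscrepancy in
/-- Off the lines `x = N` and `y = N`, on which a coloring is unconstrained, its value at a point
is that at the lower left corner of the cell of this point. -/
theorem eq_cornerValue {N : ℕ} {f : Plane → ℝ} (hf : IsColoring N f) {p : Plane}
    (h0 : p 0 ≠ N) (h1 : p 1 ≠ N) : f p = cornerValue N f (⌊p 0⌋, ⌊p 1⌋) := by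
  rw [cornerValue]
  split_ifs with hn
  · simp only [board, Finset.mem_product, Finset.mem_Ico] at hn
    obtain ⟨⟨hi0, hi⟩, hj0, hj⟩ := hn
    obtain ⟨i, hi'⟩ := Int.eq_ofNat_of_zero_le hi0
    obtain ⟨j, hj'⟩ := Int.eq_ofNat_of_zero_le hj0
    rw [hi'] at hi
    rw [hj'] at hj
    obtain ⟨c, _, h⟩ := hf.const_on_cell i (by exact_mod_cast hi) j (by exact_mod_cast hj)
    rw [hi', hj', h p, h _ (by simp [cell])]
    have e0 := Int.floor_eq_iff.1 hi'
    have e1 := Int.floor_eq_iff.1 hj'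
    exact ⟨⟨by exact_mod_cast e0.1, by exact_mod_cast e0.2⟩,
      ⟨by exact_mod_cast e1.1, by exact_mod_cast e1.2⟩⟩
  · refine hf.zero_outside p fun hp => hn ?_
    obtain ⟨⟨a0, a1⟩, b0, b1⟩ := hp
    simp only [board, Finset.mem_product, Finset.mem_Ico]
    refine ⟨⟨Int.floor_nonneg.2 a0, Int.floor_lt.2 ?_⟩, Int.floor_nonneg.2 b0, Int.floor_lt.2 ?_⟩
    · exact_mod_cast lt_of_le_of_ne a1 h0
    · exact_mod_cast lt_of_le_of_ne b1 h1

open CheckerboardDiscrepancy in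
theorem circleDiscrepancy_eq {N : ℕ} {f : Plane → ℝ} (hf : IsColoring N f) (x : Plane) {R : ℝ}
    (hR : R ≠ 0) :
    circleDiscrepancy f x R = circleSum (cornerValue N f) R (x 0, x 1) * R := by
  rw [circleDiscrepancy, intervalIntegral.integral_of_le (by positivity), integral_mul_const,
    circleSum]
  congr 1
  refine integral_congr_ae (ae_restrict_of_ae ?_)
  filter_upwards [ae_add_mul_cos_ne (x 0) N hR, ae_add_mul_sin_ne (x 1) N hR] with θ h0 h1
  have e0 : circlePoint x R θ 0 = x 0 + R * Real.cos θ := by simp [circlePoint]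
  have e1 : circlePoint x R θ 1 = x 1 + R * Real.sin θ := by simp [circlePoint]
  rw [eq_cornerValue hf (by rwa [e0]) (by rwa [e1]), e0, e1]

theorem theorem3 :
    ∃ C : ℝ, 0 < C ∧
      ∀ N : ℕ, 1 ≤ N →
        ∀ f : CheckerboardDiscrepancy.Plane → ℝ, CheckerboardDiscrepancy.IsColoring N f →
          ∃ (x : CheckerboardDiscrepancy.Plane) (R : ℝ),
            (N : ℝ) / 5 < R ∧ R < (N : ℝ) / 4 ∧
              C * (N : ℝ) ^ (1 / 2 : ℝ) ≤ |CheckerboardDiscrepancy.circleDiscrepancy f x R| := by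
  obtain ⟨c, hc, h⟩ := exists_le_mul_sq_of_circleSum_le
  refine ⟨√c / 10, by positivity, fun N hN f hf => ?_⟩
  by_contra! hcon
  have hN0 : (0 : ℝ) < N := by exact_mod_cast hN
  rw [← Real.sqrt_eq_rpow] at hcon
  -- The line element `R dθ` contributes the factor `R > N / 5`.
  have key := h N hN (cornerValue N f) (fun n hn => by simp [cornerValue, hn])
    (fun n hn => cornerValue_sq hf hn) (√c / 10 * √N * (5 / N)) fun R hR x => by
      have hR0 : 0 < R := lt_trans (by positivity) hR.1
      have h1 := hcon !₂[x.1, x.2] R hR.1 hR.2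
      rw [circleDiscrepancy_eq hf _ hR0.ne', abs_mul, abs_of_pos hR0] at h1
      simp only [Matrix.cons_val_zero, Matrix.cons_val_one] at h1
      rw [mul_div_assoc', le_div_iff₀ hN0]
      nlinarith [abs_nonneg (circleSum (cornerValue N f) R (x.1, x.2)), hR.1]
  have e : (N : ℝ) * (√c / 10 * √N * (5 / N)) ^ 2 = c / 4 := by
    rw [mul_pow, mul_pow, div_pow, div_pow, Real.sq_sqrt hc.le, Real.sq_sqrt hN0.le]
    field_simp
    norm_num
  rw [e] at key
  linarith
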